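/- Let $d\ge 0$, $n\ge 0$ be integers, let $\Gamma\subset\mathbb Z^d$ be a non-empty finite set with $D=|\Gamma|$ elements, and let $x_1,\dots,x_n$ be i.i.d. random variables uniformly distributed on $[0,1]^d$. Let $U$ be the random $n\times D$ Fourier matrix with entries $u_{tk}=e^{2\pi i\,k\cdot x_t}$ ($1\le t\le n$, $k\in\Gamma$), with the convention $n^{-1}U^*U=0$ for $n=0$. Let $\|\cdot\|$ be the operator norm with respect to the Euclidean norm on $\mathbb C^D$, let $\lambda_{\min},\lambda_{\max}$ be the smallest and largest eigenvalue of a Hermitian matrix, and let the condition number of a positive definite matrix be $\lambda_{\max}/\lambda_{\min}$. Let $0<\varepsilon<1$ and $\delta>0$. (a) Let $0<\alpha<\varepsilon^2$. If $$\left\lfloor\frac{\alpha n}{3D}\right\rfloor\ \ge\ \left[\ln\left(\frac{\varepsilon^2}{\alpha}\right)\right]^{-1}\ln\left(\frac{D}{\delta(1-\alpha)}\right),$$ then, with probability at least $1-\delta$, all of the following hold: $\|n^{-1}U^*U-I\|<\varepsilon$; $$1-\varepsilon<\lambda_{\min}(n^{-1}U^*U)\le\lambda_{\max}(n^{-1}U^*U)<1+\varepsilon;$$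 and $U^*U$ is positive definite with condition number at most $\frac{1+\varepsilon}{1-\varepsilon}$. (b) The conclusion of (a) also holds with probability at least $1-\delta$ whenever $$n\ \ge\ \frac{3De}{\varepsilon^2}\left[\ln\left(\frac D\delta\right)+2-\ln(e-1)\right].$$ (c) There is a constant $C>0$ depending only on $\varepsilon$ and $\delta$ (not on $d$, $n$ or $\Gamma$) such that, whenever $D\ge 2$ and $n\ge C\,D\ln D$, the conclusion of (a) holds with probability at least $1-\delta$. -/

import Mathlib

open MeasureTheory ProbabilityTheory

noncomputable section

namespace RandomFourier

/-- The Fourier matrix of the frequency set `Γ` and the points `x 0, …, x (n - 1)`: rows are indexed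
by the points, columns by `Γ`, and the entry at `(t, k)` is `exp (2 π i k · x t)`. -/
def fourierMatrix {d n : ℕ} (Γ : Finset (Fin d → ℤ)) (x : Fin n → Fin d → ℝ) :
    Matrix (Fin n) Γ ℂ :=
  Matrix.of fun t k =>
    Complex.exp (2 * Real.pi * Complex.I * ((∑ i, ((k : Fin d → ℤ) i : ℝ) * x t i : ℝ) : ℂ))

/-- The Gram matrix `U* U`. -/
def gram {d n : ℕ} (Γ : Finset (Fin d → ℤ)) (x : Fin n → Fin d → ℝ) : Matrix Γ Γ ℂ :=
  (fourierMatrix Γ x).conjTranspose * fourierMatrix Γ x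

/-- The normalized Gram matrix `n⁻¹ U* U`. -/
def normalizedGram {d n : ℕ} (Γ : Finset (Fin d → ℤ)) (x : Fin n → Fin d → ℝ) :
    Matrix Γ Γ ℂ :=
  (n : ℂ)⁻¹ • gram Γ x

/-- The operator norm of a square matrix with respect to the Euclidean norm. -/
def opNorm {ι : Type*} [Fintype ι] [DecidableEq ι] (A : Matrix ι ι ℂ) : ℝ :=
  ‖Matrix.toEuclideanCLM (n := ι) (𝕜 := ℂ) A‖

/-- The maximal eigenvalue of a Hermitian matrix (of positive size): its real spectrum is then
finite, non-empty and consists of all the eigenvalues. -/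
def lambdaMax {ι : Type*} [Fintype ι] [DecidableEq ι] (A : Matrix ι ι ℂ) : ℝ :=
  sSup (spectrum ℝ A)

/-- The minimal eigenvalue of a Hermitian matrix (of positive size). -/
def lambdaMin {ι : Type*} [Fintype ι] [DecidableEq ι] (A : Matrix ι ι ℂ) : ℝ :=
  sInf (spectrum ℝ A)

/-- The condition number `λ_max / λ_min` of a Hermitian positive definite matrix. -/
def condNumber {ι : Type*} [Fintype ι] [DecidableEq ι] (A : Matrix ι ι ℂ) : ℝ :=
  lambdaMax A / lambdaMin A

/-- The points `x` are i.i.d. random variables, uniformly distributed on `[0,1]^d`. -/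
structure IsUniformSample {Ω : Type*} [MeasurableSpace Ω] (μ : Measure Ω) {d n : ℕ}
    (x : Fin n → Ω → Fin d → ℝ) : Prop where
  measurable : ∀ t, Measurable (x t)
  indep : iIndepFun x μ
  uniform : ∀ t, pdf.IsUniform (x t) (Set.Icc (0 : Fin d → ℝ) 1) μ volume

/-- The outcome asserted for the points `x`: `‖n⁻¹ U* U - I‖ < ε`, the eigenvalues of `n⁻¹ U* U` lie
strictly between `1 - ε` and `1 + ε`, and `U* U` is positive definite with condition number at most
`(1 + ε) / (1 - ε)`. -/
def WellConditioned {d n : ℕ} (ε : ℝ) (Γ : Finset (Fin d → ℤ)) (x : Fin n → Fin d → ℝ) : Prop :=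
  opNorm (normalizedGram Γ x - 1) < ε ∧
  (1 - ε < lambdaMin (normalizedGram Γ x) ∧
    lambdaMin (normalizedGram Γ x) ≤ lambdaMax (normalizedGram Γ x) ∧
    lambdaMax (normalizedGram Γ x) < 1 + ε) ∧
  (0 < lambdaMin (gram Γ x) ∧ condNumber (gram Γ x) ≤ (1 + ε) / (1 - ε))

end RandomFourier

end

/-! ### The Lie product formula -/

section Trotter

open Filter Topology NormedSpace

/-! This is a matrix Chernoff bound in the style of Ahlswede and Winter. The Gram matrix `G` is a
sum of i.i.d. rank-one matrices `R` with `E R = 1` and `R² = D R`, so `exp (θ R) = 1 + s R` with `s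
= (exp (θ D) - 1) / D`. Golden–Thompson peels off one sample at a time, giving `E tr exp (θ G) ≤ D
(1 + s)ⁿ ≤ D exp (n s)` (`lintegral_trace_exp_add_smul_sum_le`). Markov's inequality with one
positive and one negative `θ` bounds each spectral tail by `D exp (-ε² n / (3 D))`.

Hence `log (2 D / δ) ≤ ε² n / (3 D)` suffices (`one_sub_le_measureReal_wellConditioned`). All three
sample-size conditions imply this when `δ < 1`, except that (a) may miss it for `D = 1`, where the
Gram matrix is deterministic. -/

theorem norm_pow_sub_pow_le_of_norm_le {R : Type*} [NormedRing R] [NormOneClass R] {a b : R} {M : ℝ}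
    (ha : ‖a‖ ≤ M) (hb : ‖b‖ ≤ M) (N : ℕ) :
    ‖a ^ (N + 1) - b ^ (N + 1)‖ ≤ (N + 1) * M ^ N * ‖a - b‖ := by
  have hM : 0 ≤ M := (norm_nonneg _).trans ha
  induction N with
  | zero => simp
  | succ N ih =>
    have key : a ^ (N + 1 + 1) - b ^ (N + 1 + 1)
        = a * (a ^ (N + 1) - b ^ (N + 1)) + (a - b) * b ^ (N + 1) := by
      rw [pow_succ' a (N + 1), pow_succ' b (N + 1)]; noncomm_ring
    have h2 : ‖b ^ (N + 1)‖ ≤ M ^ (N + 1) :=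
      (norm_pow_le _ _).trans (pow_le_pow_left₀ (norm_nonneg _) hb _)
    calc ‖a ^ (N + 1 + 1) - b ^ (N + 1 + 1)‖
        ≤ ‖a‖ * ‖a ^ (N + 1) - b ^ (N + 1)‖ + ‖a - b‖ * ‖b ^ (N + 1)‖ := by
          rw [key]
          exact (norm_add_le _ _).trans (add_le_add (norm_mul_le _ _) (norm_mul_le _ _))
      _ ≤ M * ((N + 1) * M ^ N * ‖a - b‖) + ‖a - b‖ * M ^ (N + 1) := by gcongr
      _ = _ := by push_cast; ring

variable {𝔸 : Type*} [NormedRing 𝔸] [NormOneClass 𝔸] [NormedAlgebra ℝ 𝔸] [CompleteSpace 𝔸]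

theorem norm_exp_le_real_exp_norm (x : 𝔸) : ‖exp x‖ ≤ Real.exp ‖x‖ := by
  have h := (exp_series_hasSum_exp' (𝕂 := ℝ) x).tsum_eq
  have hs : HasSum (fun n : ℕ => ‖x‖ ^ n / n.factorial) (Real.exp ‖x‖) := by
    rw [Real.exp_eq_exp_ℝ]; exact expSeries_div_hasSum_exp ‖x‖
  rw [← h]
  refine tsum_of_norm_bounded hs fun n => ?_
  rw [norm_smul, norm_inv, Real.norm_natCast, div_eq_inv_mul]
  gcongr
  exact norm_pow_le _ _

/-- The **Lie product formula**. -/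
theorem tendsto_exp_mul_exp_pow (x y : 𝔸) :
    Tendsto (fun N : ℕ => (exp (((N + 1 : ℕ) : ℝ)⁻¹ • x) * exp (((N + 1 : ℕ) : ℝ)⁻¹ • y)) ^ (N + 1))
      atTop (𝓝 (exp (x + y))) := by
  -- The two sides agree to first order at `0`, so at `t = 1 / (N + 1)` they differ by `o(1 / (N +
  -- 1))`; taking powers costs only a factor of order `N + 1`.
  have hd : HasDerivAt (fun t : ℝ => exp (t • x) * exp (t • y) - exp (t • (x + y))) 0 0 := by
    have h1 (z : 𝔸) : HasDerivAt (fun t : ℝ => exp (t • z)) z 0 := by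
      simpa using hasDerivAt_exp_smul_const (𝕂 := ℝ) z (0 : ℝ)
    have h2 := ((h1 x).mul (h1 y)).sub (h1 (x + y))
    simp only [zero_smul, exp_zero, mul_one, one_mul, sub_self] at h2
    exact h2
  have hu : Tendsto (fun N : ℕ => ((N + 1 : ℕ) : ℝ)⁻¹) atTop (𝓝 0) := by
    exact (tendsto_inv_atTop_zero.comp tendsto_natCast_atTop_atTop).comp (tendsto_add_atTop_nat 1)
  have ho := (hasDerivAt_iff_isLittleO.1 hd).comp_tendsto hu
  simp only [Function.comp_def, sub_zero, smul_zero, zero_smul, exp_zero, mul_one, sub_self] at ho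
  rw [tendsto_iff_norm_sub_tendsto_zero]
  set C : ℝ := Real.exp (‖x‖ + ‖y‖)
  have hb : ∀ N : ℕ, ‖(exp (((N + 1 : ℕ) : ℝ)⁻¹ • x) * exp (((N + 1 : ℕ) : ℝ)⁻¹ • y)) ^ (N + 1)
      - exp (x + y)‖ ≤ C * (‖exp (((N + 1 : ℕ) : ℝ)⁻¹ • x) * exp (((N + 1 : ℕ) : ℝ)⁻¹ • y)
          - exp (((N + 1 : ℕ) : ℝ)⁻¹ • (x + y))‖ / ‖((N + 1 : ℕ) : ℝ)⁻¹‖) := by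
    intro N
    set r : ℝ := ((N + 1 : ℕ) : ℝ)⁻¹ with hr
    have hr0 : 0 < r := by positivity
    have hNr : ((N + 1 : ℕ) : ℝ) * r = 1 := mul_inv_cancel₀ (by positivity)
    set M := Real.exp (r * (‖x‖ + ‖y‖)) with hMdef
    have hexp (z : 𝔸) : ‖exp (r • z)‖ ≤ Real.exp (r * ‖z‖) := by
      simpa [norm_smul, abs_of_pos hr0] using norm_exp_le_real_exp_norm (r • z)
    have ha : ‖exp (r • x) * exp (r • y)‖ ≤ M := by
      refine (norm_mul_le _ _).trans ?_
      rw [hMdef, mul_add, Real.exp_add]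
      exact mul_le_mul (hexp x) (hexp y) (norm_nonneg _) (Real.exp_pos _).le
    have hb : ‖exp (r • (x + y))‖ ≤ M :=
      (hexp _).trans (Real.exp_le_exp.2 (by gcongr; exact norm_add_le _ _))
    have hM1 : 1 ≤ M := Real.one_le_exp (by positivity)
    have hpow : exp (x + y) = exp (r • (x + y)) ^ (N + 1) := by
      let _ : NormedAlgebra ℚ 𝔸 := NormedAlgebra.restrictScalars ℚ ℝ 𝔸
      rw [← exp_nsmul, ← Nat.cast_smul_eq_nsmul ℝ, smul_smul, hNr, one_smul]
    have hMC : M ^ N ≤ C := by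
      calc M ^ N ≤ M ^ (N + 1) := pow_le_pow_right₀ hM1 (Nat.le_succ N)
        _ = C := by
          rw [hMdef, ← Real.exp_nat_mul, ← mul_assoc, hNr, one_mul]
    rw [hpow]
    refine (norm_pow_sub_pow_le_of_norm_le ha hb N).trans ?_
    have : ((N : ℝ) + 1) = 1 / r := by
      rw [hr]; push_cast; field_simp
    rw [Real.norm_of_nonneg hr0.le, this]
    calc _ = M ^ N * (‖exp (r • x) * exp (r • y) - exp (r • (x + y))‖ / r) := by ring
      _ ≤ _ := by gcongr
  refine squeeze_zero (fun _ => norm_nonneg _) hb ?_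
  have := (ho.norm_norm.tendsto_div_nhds_zero).const_mul C
  simpa using this

end Trotter

/-! ### Golden–Thompson and traces of matrix exponentials -/

section GoldenThompson

open Filter Topology NormedSpace Matrix
open scoped Matrix.Norms.L2Operator ComplexOrder

variable {ι : Type*} [Fintype ι] [DecidableEq ι]

/-- AM–GM entry by entry: `tr (Z Zᴴ)` is the sum of the squared moduli of the entries of `Z`. -/
theorem two_mul_norm_trace_mul_le {ι : Type*} [Fintype ι] (X Y : Matrix ι ι ℂ) :
    2 * ‖(X * Y).trace‖ ≤ ‖(X * Xᴴ).trace‖ + ‖(Y * Yᴴ).trace‖ := by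
  have hre (Z : Matrix ι ι ℂ) : ∑ i, ∑ j, ‖Z i j‖ ^ 2 ≤ ‖(Z * Zᴴ).trace‖ := by
    have : (Z * Zᴴ).trace = ((∑ i, ∑ j, ‖Z i j‖ ^ 2 : ℝ) : ℂ) := by
      simp [Matrix.trace, Matrix.mul_apply, Complex.mul_conj, Complex.normSq_eq_norm_sq]
    rw [this, Complex.norm_real]
    exact le_abs_self _
  have hY : ∑ i, ∑ j, ‖Y i j‖ ^ 2 = ∑ i, ∑ j, ‖Y j i‖ ^ 2 := Finset.sum_comm
  calc 2 * ‖(X * Y).trace‖ ≤ 2 * ∑ i, ∑ j, ‖X i j‖ * ‖Y j i‖ := by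
        gcongr
        simp only [Matrix.trace, Matrix.diag_apply, Matrix.mul_apply]
        refine (norm_sum_le _ _).trans (Finset.sum_le_sum fun i _ => ?_)
        refine (norm_sum_le _ _).trans (Finset.sum_le_sum fun j _ => ?_)
        exact norm_mul_le _ _
    _ ≤ ∑ i, ∑ j, ‖X i j‖ ^ 2 + ∑ i, ∑ j, ‖Y j i‖ ^ 2 := by
        rw [Finset.mul_sum, ← Finset.sum_add_distrib]
        refine Finset.sum_le_sum fun i _ => ?_
        rw [Finset.mul_sum, ← Finset.sum_add_distrib]
        refine Finset.sum_le_sum fun j _ => ?_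
        nlinarith [sq_nonneg (‖X i j‖ - ‖Y j i‖)]
    _ ≤ _ := by rw [← hY]; exact add_le_add (hre X) (hre Y)

theorem trace_mul_pow_comm (X Y : Matrix ι ι ℂ) (n : ℕ) :
    ((X * Y) ^ n).trace = ((Y * X) ^ n).trace := by
  cases n with
  | zero => simp
  | succ n =>
    have : (X * Y) ^ (n + 1) = X * (Y * X) ^ n * Y := by
      induction n with
      | zero => simp
      | succ n ih => rw [pow_succ, ih, pow_succ (Y * X) n]; noncomm_ring
    rw [this, Matrix.trace_mul_comm, ← mul_assoc, ← pow_succ']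

/-- The two claims feed each other. The first at `k + 1` applies the first at `k` to `M ^ 2`, cycles
the trace to reach `MᴴM * MMᴴ`, and uses the second with AM–GM. The second at `k + 1` applies the
first at `k` to `A * B`, cycles to `A ^ 2 * B ^ 2`, and uses the second. -/
theorem norm_trace_pow_two_pow_le_and (k : ℕ) :
    (∀ M : Matrix ι ι ℂ, ‖(M ^ 2 ^ (k + 1)).trace‖ ≤ ‖((M * Mᴴ) ^ 2 ^ k).trace‖) ∧
    (∀ A B : Matrix ι ι ℂ, A.IsHermitian → B.IsHermitian →
      ‖((A * B) ^ 2 ^ k).trace‖ ≤ ‖(A ^ 2 ^ k * B ^ 2 ^ k).trace‖) := by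
  induction k with
  | zero =>
    refine ⟨fun M => ?_, fun A B _ _ => by simp⟩
    have := two_mul_norm_trace_mul_le M M
    simp only [zero_add, pow_one, pow_zero, pow_two]
    linarith
  | succ k ih =>
    obtain ⟨ihP, ihQ⟩ := ih
    refine ⟨fun M => ?_, fun A B hA hB => ?_⟩
    · have hA : (Mᴴ * M).IsHermitian := isHermitian_conjTranspose_mul_self M
      have hB : (M * Mᴴ).IsHermitian := isHermitian_mul_conjTranspose_self M
      have h1 := ihP (M ^ 2)
      rw [← pow_mul, ← pow_succ'] at h1
      have h2 : (((M ^ 2) * (M ^ 2)ᴴ) ^ 2 ^ k).trace = ((Mᴴ * M * (M * Mᴴ)) ^ 2 ^ k).trace := by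
        have e1 : M ^ 2 * (M ^ 2)ᴴ = (M * M * Mᴴ) * Mᴴ := by
          rw [conjTranspose_pow]; noncomm_ring
        rw [e1, trace_mul_pow_comm]
        congr 2; noncomm_ring
      have h3 := ihQ _ _ hA hB
      have h4 := two_mul_norm_trace_mul_le ((Mᴴ * M) ^ 2 ^ k) ((M * Mᴴ) ^ 2 ^ k)
      rw [(hA.pow _).eq, (hB.pow _).eq, ← pow_add, ← pow_add, ← two_mul, ← pow_succ',
        trace_mul_pow_comm Mᴴ M] at h4
      rw [h2] at h1
      linarith
    · have h1 := ihP (A * B)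
      rw [conjTranspose_mul, hA.eq, hB.eq] at h1
      have h2 : ((A * B * (B * A)) ^ 2 ^ k).trace = ((A ^ 2 * B ^ 2) ^ 2 ^ k).trace := by
        rw [← mul_assoc, trace_mul_pow_comm]
        congr 2; noncomm_ring
      have h3 := ihQ _ _ (hA.pow 2) (hB.pow 2)
      rw [← pow_mul, ← pow_mul, ← pow_succ'] at h3
      rw [h2] at h1
      exact h1.trans h3

/-- The **Golden–Thompson inequality**. -/
theorem norm_trace_exp_add_le [Nonempty ι] {A B : Matrix ι ι ℂ} (hA : A.IsHermitian)
    (hB : B.IsHermitian) : ‖(exp (A + B)).trace‖ ≤ ‖(exp A * exp B).trace‖ := by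
  -- Pass to the subsequence `N + 1 = 2 ^ k` of the Lie product formula.
  have hsub : Tendsto (fun k : ℕ => 2 ^ k - 1) atTop atTop := by
    refine tendsto_atTop_mono (fun k => ?_) tendsto_id
    have := Nat.lt_two_pow_self (n := k)
    simp only [id]; omega
  have ht := (tendsto_exp_mul_exp_pow A B).comp hsub
  have hc : Continuous fun Z : Matrix ι ι ℂ => ‖Z.trace‖ :=
    continuous_norm.comp continuous_id.matrix_trace
  refine le_of_tendsto ((hc.tendsto _).comp ht) (Eventually.of_forall fun k => ?_)
  have hk : 2 ^ k - 1 + 1 = 2 ^ k := Nat.sub_add_cancel Nat.one_le_two_pow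
  simp only [Function.comp_apply, hk]
  have hherm {Z : Matrix ι ι ℂ} (hZ : Z.IsHermitian) :
      (exp (((2 ^ k : ℕ) : ℝ)⁻¹ • Z)).IsHermitian := by
    apply Matrix.IsHermitian.exp
    simp [Matrix.IsHermitian, hZ.eq]
  have hpow (Z : Matrix ι ι ℂ) : exp (((2 ^ k : ℕ) : ℝ)⁻¹ • Z) ^ 2 ^ k = exp Z := by
    rw [← Matrix.exp_nsmul, ← Nat.cast_smul_eq_nsmul ℝ, smul_smul,
      mul_inv_cancel₀ (by positivity), one_smul]
  have := (norm_trace_pow_two_pow_le_and k).2 _ _ (hherm hA) (hherm hB)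
  rwa [hpow, hpow] at this

/-- The trace equals `tr (Cᴴ C)` with `C = exp (A / 2) exp (B / 2)`. -/
theorem trace_exp_mul_exp_nonneg {A B : Matrix ι ι ℂ} (hA : A.IsHermitian)
    (hB : B.IsHermitian) : 0 ≤ (exp A * exp B).trace := by
  have hsplit (Z : Matrix ι ι ℂ) :
      exp Z = exp ((2⁻¹ : ℝ) • Z) * exp ((2⁻¹ : ℝ) • Z) := by
    rw [← Matrix.exp_add_of_commute _ _ (Commute.refl _), ← add_smul]
    norm_num
  have hherm {Z : Matrix ι ι ℂ} (hZ : Z.IsHermitian) : (exp ((2⁻¹ : ℝ) • Z)).IsHermitian := by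
    apply Matrix.IsHermitian.exp
    simp [Matrix.IsHermitian, hZ.eq]
  have h := (posSemidef_conjTranspose_mul_self
    (exp ((2⁻¹ : ℝ) • A) * exp ((2⁻¹ : ℝ) • B))).trace_nonneg
  rw [conjTranspose_mul, (hherm hA).eq, (hherm hB).eq] at h
  rw [hsplit A, hsplit B]
  convert h using 1
  rw [← mul_assoc, Matrix.trace_mul_comm]
  congr 1
  noncomm_ring

theorem trace_exp_eq_sum_exp_eigenvalues {A : Matrix ι ι ℂ} (hA : A.IsHermitian) :
    (exp A).trace = ((∑ i, Real.exp (hA.eigenvalues i) : ℝ) : ℂ) := by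
  set V := Unitary.toUnits hA.eigenvectorUnitary
  have hs : A = (V : Matrix ι ι ℂ) * diagonal (RCLike.ofReal ∘ hA.eigenvalues)
      * ((V⁻¹ : (Matrix ι ι ℂ)ˣ) : Matrix ι ι ℂ) := by
    conv_lhs => rw [hA.spectral_theorem]
    rfl
  conv_lhs => rw [hs, Matrix.exp_units_conj, Matrix.trace_mul_comm, ← mul_assoc, Units.inv_mul,
    one_mul, Matrix.exp_diagonal, Matrix.trace_diagonal]
  simp [← Complex.exp_eq_exp_ℂ]

theorem re_trace_exp_add_le [Nonempty ι] {A B : Matrix ι ι ℂ} (hA : A.IsHermitian)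
    (hB : B.IsHermitian) : (exp (A + B)).trace.re ≤ (exp A * exp B).trace.re := by
  refine (Complex.re_le_norm _).trans ((norm_trace_exp_add_le hA hB).trans_eq ?_)
  have h := Complex.le_def.1 (trace_exp_mul_exp_nonneg hA hB)
  have : (exp A * exp B).trace = ((exp A * exp B).trace.re : ℂ) :=
    Complex.ext (by simp) (by simpa using h.2.symm)
  rw [this, Complex.norm_real, Real.norm_of_nonneg (by simpa using h.1), Complex.ofReal_re]

theorem exp_smul_of_isIdempotentElem {Q : Matrix ι ι ℂ} (hQ : Q * Q = Q) (t : ℝ) :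
    exp (t • Q) = 1 + (Real.exp t - 1) • Q := by
  have h := exp_series_hasSum_exp' (𝕂 := ℝ) (t • Q)
  have hs : HasSum (fun n : ℕ => t ^ n / n.factorial) (Real.exp t) := by
    rw [Real.exp_eq_exp_ℝ]; exact expSeries_div_hasSum_exp t
  -- Every power of `Q` is `Q` except the zeroth, whence the correction `1 - Q` at `n = 0`.
  have h' := (hs.smul_const Q).add (hasSum_ite_eq (0 : ℕ) (1 - Q))
  have heq : (fun n : ℕ => ((n.factorial : ℝ)⁻¹) • (t • Q) ^ n)
      = fun n : ℕ => (t ^ n / n.factorial) • Q + if n = 0 then 1 - Q else 0 := by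
    funext n
    cases n with
    | zero => simp
    | succ n =>
      have : Q ^ (n + 1) = Q := by
        induction n with
        | zero => simp
        | succ n ih => rw [pow_succ, ih, hQ]
      rw [smul_pow, this, smul_smul, if_neg (Nat.succ_ne_zero n), add_zero]
      congr 1; ring
  rw [heq] at h
  rw [h.unique h', sub_smul, one_smul]
  abel

end GoldenThompson

namespace RandomFourier

/-! ### Reduction to the spectrum of the Gram matrix -/

section Spectral

open Matrix
open scoped Matrix.Norms.L2Operator

theorem lambda_bounds_of_spectrum_subset {ι : Type*} [Fintype ι] [DecidableEq ι] [Nonempty ι]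
    {A : Matrix ι ι ℂ} (hA : A.IsHermitian) {a b : ℝ} (h : spectrum ℝ A ⊆ Set.Ioo a b) :
    a < lambdaMin A ∧ lambdaMin A ≤ lambdaMax A ∧ lambdaMax A < b := by
  have hfin : (spectrum ℝ A).Finite := A.finite_real_spectrum
  have hne : (spectrum ℝ A).Nonempty :=
    ⟨_, hA.eigenvalues_mem_spectrum_real (Classical.arbitrary ι)⟩
  exact ⟨(h (hne.csInf_mem hfin)).1, csInf_le_csSup hne hfin.bddBelow hfin.bddAbove,
    (h (hne.csSup_mem hfin)).2⟩

theorem opNorm_sub_one_lt_of_spectrum_subset {ι : Type*} [Fintype ι] [DecidableEq ι] [Nonempty ι]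
    {A : Matrix ι ι ℂ} (hA : A.IsHermitian) {ε : ℝ}
    (h : spectrum ℝ A ⊆ Set.Ioo (1 - ε) (1 + ε)) : opNorm (A - 1) < ε := by
  have hsa : IsSelfAdjoint (A - 1) := IsSelfAdjoint.sub hA (IsSelfAdjoint.one _)
  have hmem : ∀ r : ℝ, r ∈ spectrum ℝ (A - 1) → r + 1 ∈ spectrum ℝ A := by
    intro r hr
    rw [← map_one (algebraMap ℝ (Matrix ι ι ℂ)), ← spectrum.sub_singleton_eq] at hr
    obtain ⟨s, hs, t, ht, rfl⟩ := hr
    simpa [Set.mem_singleton_iff.1 ht] using hs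
  rw [opNorm, Matrix.l2_opNorm_toEuclideanCLM]
  rcases CStarAlgebra.norm_or_neg_norm_mem_spectrum hsa with h1 | h1
  · linarith [(h (hmem _ h1)).2]
  · linarith [(h (hmem _ h1)).1]

variable {d n : ℕ} (Γ : Finset (Fin d → ℤ)) (x : Fin n → Fin d → ℝ)

theorem isHermitian_gram : (gram Γ x).IsHermitian :=
  isHermitian_conjTranspose_mul_self _

theorem normalizedGram_eq_real_smul : normalizedGram Γ x = (n : ℝ)⁻¹ • gram Γ x := by
  ext k l
  simp [normalizedGram]

variable {Γ x}

theorem wellConditioned_of_spectrum_gram_subset (hΓ : Γ.Nonempty) (hn : 0 < n) {ε : ℝ}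
    (hε1 : ε < 1)
    (h : spectrum ℝ (gram Γ x) ⊆ Set.Ioo ((1 - ε) * n) ((1 + ε) * n)) :
    WellConditioned ε Γ x := by
  have : Nonempty Γ := hΓ.to_subtype
  have hn' : (0 : ℝ) < n := Nat.cast_pos.2 hn
  have hN : (normalizedGram Γ x).IsHermitian := by
    rw [normalizedGram_eq_real_smul]
    simp [Matrix.IsHermitian, (isHermitian_gram Γ x).eq]
  have hspec : spectrum ℝ (normalizedGram Γ x) ⊆ Set.Ioo (1 - ε) (1 + ε) := by
    intro r hr
    have hr' : (n : ℝ) * r ∈ spectrum ℝ (gram Γ x) := by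
      have := (spectrum.smul_mem_smul_iff (r := Units.mk0 (n : ℝ) hn'.ne')).2 hr
      simpa [Units.smul_def, normalizedGram_eq_real_smul, smul_smul, hn'.ne'] using this
    obtain ⟨h1, h2⟩ := h hr'
    constructor <;> nlinarith
  obtain ⟨h1, h2, h3⟩ := lambda_bounds_of_spectrum_subset (isHermitian_gram Γ x) h
  have hlow : 0 < (1 - ε) * n := mul_pos (by linarith) hn'
  refine ⟨opNorm_sub_one_lt_of_spectrum_subset hN hspec,
    lambda_bounds_of_spectrum_subset hN hspec, hlow.trans h1, ?_⟩
  rw [condNumber, ← mul_div_mul_right (1 + ε) (1 - ε) hn'.ne']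
  exact div_le_div₀ ((hlow.trans h1).le.trans (h2.trans h3.le)) h3.le hlow h1.le

end Spectral

end RandomFourier

noncomputable section

namespace RandomFourier

open Matrix NormedSpace
open scoped Matrix.Norms.L2Operator

/-! ### Rank-one summands of the Gram matrix -/

section RankOne

variable {d : ℕ} (Γ : Finset (Fin d → ℤ))

/-- The row of the Fourier matrix that belongs to the sampling point `y`. -/
def fourierRow (y : Fin d → ℝ) : Γ → ℂ := fun k =>
  Complex.exp (2 * Real.pi * Complex.I * ((∑ i, ((k : Fin d → ℤ) i : ℝ) * y i : ℝ) : ℂ))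

/-- The contribution of the sampling point `y` to the Gram matrix. -/
def rankOneGram (y : Fin d → ℝ) : Matrix Γ Γ ℂ :=
  vecMulVec (star (fourierRow Γ y)) (fourierRow Γ y)

theorem gram_eq_sum_rankOneGram {n : ℕ} (x : Fin n → Fin d → ℝ) :
    gram Γ x = ∑ t, rankOneGram Γ (x t) := by
  ext k l
  simp [gram, fourierMatrix, rankOneGram, fourierRow, Matrix.mul_apply, Matrix.sum_apply,
    vecMulVec_apply]

theorem isHermitian_rankOneGram (y : Fin d → ℝ) : (rankOneGram Γ y).IsHermitian := by
  ext k l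
  simp [rankOneGram, vecMulVec_apply, mul_comm]

theorem fourierRow_eq_exp_mul_I (y : Fin d → ℝ) (k : Γ) : fourierRow Γ y k =
    Complex.exp (((2 * Real.pi * ∑ i, ((k : Fin d → ℤ) i : ℝ) * y i : ℝ) : ℂ) * Complex.I) := by
  rw [fourierRow]
  congr 1
  push_cast
  ring

theorem norm_fourierRow (y : Fin d → ℝ) (k : Γ) : ‖fourierRow Γ y k‖ = 1 := by
  rw [fourierRow_eq_exp_mul_I, Complex.norm_exp_ofReal_mul_I]

theorem continuous_fourierRow : Continuous (fourierRow Γ) := by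
  unfold fourierRow
  fun_prop

theorem continuous_rankOneGram : Continuous (rankOneGram Γ) :=
  (continuous_fourierRow Γ).star.matrix_vecMulVec (continuous_fourierRow Γ)

theorem norm_rankOneGram_apply (y : Fin d → ℝ) (k l : Γ) : ‖rankOneGram Γ y k l‖ = 1 := by
  simp [rankOneGram, vecMulVec_apply, norm_fourierRow]

/-- The row has `D` entries of modulus one, hence squared norm `D`; thus `D⁻¹ R` is a projection. -/
theorem rankOneGram_mul_self (y : Fin d → ℝ) :
    rankOneGram Γ y * rankOneGram Γ y = (Γ.card : ℝ) • rankOneGram Γ y := by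
  have h : fourierRow Γ y ⬝ᵥ star (fourierRow Γ y) = (Γ.card : ℂ) := by
    simp [dotProduct, Complex.mul_conj, Complex.normSq_eq_norm_sq, norm_fourierRow]
  rw [rankOneGram, vecMulVec_mul_vecMulVec, h]
  ext k l
  simp [vecMulVec_apply]
  ring

variable {Γ}

theorem exp_smul_rankOneGram (hΓ : Γ.Nonempty) (θ : ℝ) (y : Fin d → ℝ) :
    exp (θ • rankOneGram Γ y) =
      1 + ((Real.exp (θ * Γ.card) - 1) / Γ.card) • rankOneGram Γ y := by
  have hD : (Γ.card : ℝ) ≠ 0 := by exact_mod_cast hΓ.card_pos.ne'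
  have hQ : ((Γ.card : ℝ)⁻¹ • rankOneGram Γ y) * ((Γ.card : ℝ)⁻¹ • rankOneGram Γ y)
      = (Γ.card : ℝ)⁻¹ • rankOneGram Γ y := by
    rw [smul_mul_smul_comm, rankOneGram_mul_self, smul_smul]
    congr 1
    field_simp
  have h := exp_smul_of_isIdempotentElem hQ (θ * Γ.card)
  rwa [smul_smul, smul_smul, mul_assoc, mul_inv_cancel₀ hD, mul_one, ← div_eq_mul_inv] at h

end RankOne

/-! ### Orthogonality of characters: each summand has mean the identity -/

section Orthogonality

theorem integral_Icc_exp_two_pi_mul_I (m : ℤ) :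
    ∫ t in Set.Icc (0 : ℝ) 1, Complex.exp (2 * Real.pi * Complex.I * m * t) =
      if m = 0 then 1 else 0 := by
  rw [integral_Icc_eq_integral_Ioc, ← intervalIntegral.integral_of_le zero_le_one]
  split_ifs with h
  · simp [h]
  · have hc : (2 * Real.pi * Complex.I * m : ℂ) ≠ 0 :=
      mul_ne_zero Complex.two_pi_I_ne_zero (by exact_mod_cast h)
    rw [integral_exp_mul_complex hc]
    have : Complex.exp (2 * Real.pi * Complex.I * m) = 1 :=
      Complex.exp_eq_one_iff.2 ⟨m, by ring⟩
    simp [this]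

variable {d : ℕ} (Γ : Finset (Fin d → ℤ))

theorem integral_rankOneGram_apply (k l : Γ) :
    ∫ y in Set.Icc (0 : Fin d → ℝ) 1, rankOneGram Γ y k l = (1 : Matrix Γ Γ ℂ) k l := by
  have hprod : ∀ y : Fin d → ℝ, rankOneGram Γ y k l =
      ∏ i, Complex.exp (2 * Real.pi * Complex.I * ((l : Fin d → ℤ) i - (k : Fin d → ℤ) i : ℤ)
        * (y i : ℂ)) := by
    intro y
    rw [rankOneGram, vecMulVec_apply, Pi.star_apply, fourierRow_eq_exp_mul_I,
      fourierRow_eq_exp_mul_I, RCLike.star_def, ← Complex.exp_conj, ← Complex.exp_add,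
      ← Complex.exp_sum]
    congr 1
    simp only [map_mul, Complex.conj_ofReal, Complex.conj_I]
    push_cast
    simp only [Finset.mul_sum, Finset.sum_mul, ← Finset.sum_add_distrib]
    refine Finset.sum_congr rfl fun i _ => ?_
    ring
  have hmeas : (volume : Measure (Fin d → ℝ)).restrict (Set.Icc 0 1) =
      Measure.pi fun _ : Fin d => (volume : Measure ℝ).restrict (Set.Icc 0 1) := by
    rw [← Measure.restrict_pi_pi, Set.pi_univ_Icc]; rfl
  simp_rw [hprod]
  rw [hmeas, integral_fintype_prod_eq_prod
    (f := fun i (t : ℝ) => Complex.exp (2 * Real.pi * Complex.I *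
      ((l : Fin d → ℤ) i - (k : Fin d → ℤ) i : ℤ) * (t : ℂ)))]
  simp_rw [integral_Icc_exp_two_pi_mul_I, sub_eq_zero]
  rw [Matrix.one_apply, Finset.prod_ite_zero]
  simp only [Finset.mem_univ, true_implies, Finset.prod_const_one, eq_comm (a := k),
    Subtype.ext_iff, funext_iff]

end Orthogonality

end RandomFourier

end

noncomputable section

namespace RandomFourier

open Matrix NormedSpace
open scoped Matrix.Norms.L2Operator

/-! ### The exponential trace moment -/

section Moment

variable {d : ℕ} {Γ : Finset (Fin d → ℤ)}

instance isProbabilityMeasure_restrict_Icc (d : ℕ) :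
    IsProbabilityMeasure ((volume : Measure (Fin d → ℝ)).restrict (Set.Icc 0 1)) :=
  ⟨by simp [Real.volume_Icc_pi]⟩

theorem continuous_re_trace_exp :
    Continuous fun A : Matrix Γ Γ ℂ => (exp A).trace.re := by
  let _ : NormedAlgebra ℚ (Matrix Γ Γ ℂ) := NormedAlgebra.restrictScalars ℚ ℝ _
  exact Complex.continuous_re.comp
    (Continuous.matrix_trace (exp_continuous (𝔸 := Matrix Γ Γ ℂ)))

theorem integral_trace_mul_rankOneGram (E : Matrix Γ Γ ℂ) :
    Integrable (fun y => (E * rankOneGram Γ y).trace) (volume.restrict (Set.Icc 0 1)) ∧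
      ∫ y in Set.Icc (0 : Fin d → ℝ) 1, (E * rankOneGram Γ y).trace = E.trace := by
  have hint (k l : Γ) : Integrable (fun y => rankOneGram Γ y k l)
      (volume.restrict (Set.Icc (0 : Fin d → ℝ) 1)) := by
    refine Integrable.of_bound (C := 1) ?_ (Filter.Eventually.of_forall fun y =>
      (norm_rankOneGram_apply Γ y k l).le)
    exact ((continuous_rankOneGram Γ).matrix_elem k l).aestronglyMeasurable
  have hsum (k : Γ) : Integrable (fun y => ∑ l, E k l * rankOneGram Γ y l k)
      (volume.restrict (Set.Icc (0 : Fin d → ℝ) 1)) :=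
    integrable_finsetSum _ fun l _ => (hint l k).const_mul _
  simp only [Matrix.trace, Matrix.diag_apply, Matrix.mul_apply]
  refine ⟨integrable_finsetSum _ fun k _ => hsum k,
    (integral_finsetSum _ fun k _ => hsum k).trans (Finset.sum_congr rfl fun k _ => ?_)⟩
  refine (integral_finsetSum _ fun l _ => (hint l k).const_mul (E k l)).trans ?_
  simp_rw [integral_const_mul, integral_rankOneGram_apply]
  simp [Matrix.one_apply]

/-- The expected factor that one sampling point contributes to the exponential moment. -/
def momentFactor (Γ : Finset (Fin d → ℤ)) (θ : ℝ) : ℝ :=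
  1 + (Real.exp (θ * Γ.card) - 1) / Γ.card

theorem momentFactor_nonneg (hΓ : Γ.Nonempty) (θ : ℝ) : 0 ≤ momentFactor Γ θ := by
  have hD : (1 : ℝ) ≤ Γ.card := by exact_mod_cast hΓ.card_pos
  have : -1 ≤ (Real.exp (θ * Γ.card) - 1) / Γ.card := by
    rw [le_div_iff₀ (by linarith)]
    linarith [Real.exp_pos (θ * Γ.card)]
  unfold momentFactor
  linarith

/-- After Golden–Thompson the integrand is affine in `R`, so its mean is computed exactly from `E R
= 1`. -/
theorem lintegral_trace_exp_add_smul_rankOneGram_le (hΓ : Γ.Nonempty) (θ : ℝ)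
    {A : Matrix Γ Γ ℂ} (hA : A.IsHermitian) :
    ∫⁻ y in Set.Icc (0 : Fin d → ℝ) 1,
        ENNReal.ofReal (exp (A + θ • rankOneGram Γ y)).trace.re ≤
      ENNReal.ofReal (momentFactor Γ θ) * ENNReal.ofReal (exp A).trace.re := by
  have : Nonempty Γ := hΓ.to_subtype
  obtain ⟨hint, hval⟩ := integral_trace_mul_rankOneGram (exp A)
  have hB (y : Fin d → ℝ) : (θ • rankOneGram Γ y).IsHermitian := by
    simp [Matrix.IsHermitian, (isHermitian_rankOneGram Γ y).eq]
  set s := (Real.exp (θ * Γ.card) - 1) / Γ.card with hs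
  have heq (y : Fin d → ℝ) : (exp A * exp (θ • rankOneGram Γ y)).trace.re =
      (exp A).trace.re + s * (exp A * rankOneGram Γ y).trace.re := by
    rw [exp_smul_rankOneGram hΓ, mul_add, mul_one, Matrix.trace_add, mul_smul_comm,
      Matrix.trace_smul, Complex.add_re, Complex.smul_re, smul_eq_mul]
  have hre : Integrable (fun y => (exp A * rankOneGram Γ y).trace.re)
      (volume.restrict (Set.Icc 0 1)) := hint.re
  have hintre : Integrable (fun y => (exp A).trace.re + s * (exp A * rankOneGram Γ y).trace.re)
      (volume.restrict (Set.Icc 0 1)) :=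
    (integrable_const _).add (hre.const_mul s)
  calc ∫⁻ y in Set.Icc (0 : Fin d → ℝ) 1,
        ENNReal.ofReal (exp (A + θ • rankOneGram Γ y)).trace.re
      ≤ ∫⁻ y in Set.Icc (0 : Fin d → ℝ) 1,
        ENNReal.ofReal ((exp A).trace.re + s * (exp A * rankOneGram Γ y).trace.re) := by
        refine lintegral_mono fun y => ENNReal.ofReal_le_ofReal ?_
        rw [← heq]
        exact re_trace_exp_add_le hA (hB y)
    _ = ENNReal.ofReal (∫ y in Set.Icc (0 : Fin d → ℝ) 1,
          ((exp A).trace.re + s * (exp A * rankOneGram Γ y).trace.re)) := by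
        refine (ofReal_integral_eq_lintegral_ofReal hintre
          (Filter.Eventually.of_forall fun y => ?_)).symm
        change 0 ≤ (exp A).trace.re + s * (exp A * rankOneGram Γ y).trace.re
        rw [← heq]
        exact (Complex.le_def.1 (trace_exp_mul_exp_nonneg hA (hB y))).1
    _ = ENNReal.ofReal (momentFactor Γ θ * (exp A).trace.re) := by
        have hval_re : ∫ y in Set.Icc (0 : Fin d → ℝ) 1, (exp A * rankOneGram Γ y).trace.re
            = (exp A).trace.re := by
          rw [← hval]
          exact integral_re hint
        rw [integral_add (integrable_const _) (hre.const_mul s), integral_const_mul, hval_re]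
        congr 1
        simp only [integral_const, probReal_univ, one_smul, momentFactor, ← hs]
        ring
    _ = _ := ENNReal.ofReal_mul (momentFactor_nonneg hΓ θ)

/-- Induction with `A` arbitrary: by Fubini the first sample is frozen and absorbed into `A`, then
integrated last. -/
theorem lintegral_trace_exp_add_smul_sum_le (hΓ : Γ.Nonempty) (θ : ℝ) (n : ℕ) :
    ∀ {A : Matrix Γ Γ ℂ}, A.IsHermitian →
    ∫⁻ x, ENNReal.ofReal (exp (A + θ • ∑ t, rankOneGram Γ (x t))).trace.re
        ∂(Measure.pi fun _ : Fin n => (volume : Measure (Fin d → ℝ)).restrict (Set.Icc 0 1)) ≤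
      ENNReal.ofReal (momentFactor Γ θ) ^ n * ENNReal.ofReal (exp A).trace.re := by
  induction n with
  | zero => intro A _; simp
  | succ n ih =>
    intro A hA
    have hB (y : Fin d → ℝ) : (A + θ • rankOneGram Γ y).IsHermitian := by
      simp [Matrix.IsHermitian, (isHermitian_rankOneGram Γ y).eq, hA.eq]
    have hmp := measurePreserving_piFinSuccAbove
      (fun _ : Fin (n + 1) => (volume : Measure (Fin d → ℝ)).restrict (Set.Icc 0 1)) 0
    have hmeas : Measurable fun p : (Fin d → ℝ) × (Fin n → Fin d → ℝ) => ENNReal.ofReal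
        (exp (A + θ • rankOneGram Γ p.1 + θ • ∑ t, rankOneGram Γ (p.2 t))).trace.re := by
      refine (continuous_re_trace_exp.comp ?_).measurable.ennreal_ofReal
      have hc := continuous_rankOneGram Γ
      fun_prop
    have hcongr (x : Fin (n + 1) → Fin d → ℝ) :
        ENNReal.ofReal (exp (A + θ • ∑ t, rankOneGram Γ (x t))).trace.re =
        (fun p : (Fin d → ℝ) × (Fin n → Fin d → ℝ) => ENNReal.ofReal
          (exp (A + θ • rankOneGram Γ p.1 + θ • ∑ t, rankOneGram Γ (p.2 t))).trace.re)
        (MeasurableEquiv.piFinSuccAbove (fun _ => Fin d → ℝ) 0 x) := by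
      rw [Fin.sum_univ_succ, smul_add, ← add_assoc]
      rfl
    simp_rw [hcongr]
    rw [hmp.lintegral_comp hmeas, lintegral_prod _ hmeas.aemeasurable]
    calc _ ≤ ∫⁻ y in Set.Icc (0 : Fin d → ℝ) 1, ENNReal.ofReal (momentFactor Γ θ) ^ n *
            ENNReal.ofReal (exp (A + θ • rankOneGram Γ y)).trace.re :=
          lintegral_mono fun y => ih (hB y)
      _ = ENNReal.ofReal (momentFactor Γ θ) ^ n * ∫⁻ y in Set.Icc (0 : Fin d → ℝ) 1,
            ENNReal.ofReal (exp (A + θ • rankOneGram Γ y)).trace.re := by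
          refine lintegral_const_mul _ ?_
          refine (continuous_re_trace_exp.comp ?_).measurable.ennreal_ofReal
          have hc := continuous_rankOneGram Γ
          fun_prop
      _ ≤ ENNReal.ofReal (momentFactor Γ θ) ^ n *
            (ENNReal.ofReal (momentFactor Γ θ) * ENNReal.ofReal (exp A).trace.re) := by
          gcongr
          exact lintegral_trace_exp_add_smul_rankOneGram_le hΓ θ hA
      _ = _ := by rw [← mul_assoc, ← pow_succ]

end Moment

/-! ### Tail bounds and the core probability estimate -/

section Tail

variable {d n : ℕ} {Γ : Finset (Fin d → ℤ)} {Ω : Type*} [MeasurableSpace Ω] {μ : Measure Ω}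
  [IsProbabilityMeasure μ] {x : Fin n → Ω → Fin d → ℝ}

theorem IsUniformSample.map_eq_pi (hx : IsUniformSample μ x) :
    μ.map (fun ω t => x t ω) =
      Measure.pi fun _ : Fin n => (volume : Measure (Fin d → ℝ)).restrict (Set.Icc 0 1) := by
  rw [(iIndepFun_iff_map_fun_eq_pi_map fun t => (hx.measurable t).aemeasurable).1 hx.indep]
  congr 1
  funext t
  rw [hx.uniform t, ProbabilityTheory.cond]
  simp [Real.volume_Icc_pi]

/-- Markov's inequality for the moment bound at `A = 0`, where `tr exp 0 = D`, with `1 + s ≤ exp s`.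
-/
theorem IsUniformSample.measure_le_trace_exp_gram (hx : IsUniformSample μ x) (hΓ : Γ.Nonempty)
    (θ a : ℝ) :
    μ {ω | Real.exp a ≤ (exp (θ • gram Γ fun t => x t ω)).trace.re} ≤
      ENNReal.ofReal (Γ.card * Real.exp (n * ((Real.exp (θ * Γ.card) - 1) / Γ.card) - a)) := by
  have hX : Measurable fun ω t => x t ω := measurable_pi_lambda _ hx.measurable
  have hF : Measurable fun z : Fin n → Fin d → ℝ =>
      ENNReal.ofReal (exp (θ • gram Γ z)).trace.re := by
    refine (continuous_re_trace_exp.comp ?_).measurable.ennreal_ofReal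
    have hc := continuous_rankOneGram Γ
    simp_rw [gram_eq_sum_rankOneGram]
    fun_prop
  have hmom : ∫⁻ ω, ENNReal.ofReal (exp (θ • gram Γ fun t => x t ω)).trace.re ∂μ ≤
      ENNReal.ofReal (Γ.card * Real.exp (n * ((Real.exp (θ * Γ.card) - 1) / Γ.card))) := by
    rw [← lintegral_map hF hX, hx.map_eq_pi]
    simp_rw [gram_eq_sum_rankOneGram]
    have h := lintegral_trace_exp_add_smul_sum_le hΓ θ n (isHermitian_zero (n := Γ) (α := ℂ))
    simp only [zero_add] at h
    refine h.trans ?_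
    rw [exp_zero, Matrix.trace_one, ← ENNReal.ofReal_pow (momentFactor_nonneg hΓ θ),
      ← ENNReal.ofReal_mul (pow_nonneg (momentFactor_nonneg hΓ θ) n), mul_comm]
    refine ENNReal.ofReal_le_ofReal ?_
    rw [Real.exp_nat_mul]
    simp only [Fintype.card_coe, Complex.natCast_re]
    gcongr
    · exact momentFactor_nonneg hΓ θ
    · rw [momentFactor, add_comm]
      exact Real.add_one_le_exp _
  have hmarkov := mul_meas_ge_le_lintegral (μ := μ) (hF.comp hX) (ENNReal.ofReal (Real.exp a))
  have hsub : {ω | Real.exp a ≤ (exp (θ • gram Γ fun t => x t ω)).trace.re} ⊆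
      {ω | ENNReal.ofReal (Real.exp a) ≤
        ((fun z : Fin n → Fin d → ℝ => ENNReal.ofReal (exp (θ • gram Γ z)).trace.re) ∘
          fun ω t => x t ω) ω} := fun ω hω => ENNReal.ofReal_le_ofReal hω
  refine (measure_mono hsub).trans ?_
  rw [Real.exp_sub, mul_div_assoc', ENNReal.ofReal_div_of_pos (Real.exp_pos a)]
  rw [ENNReal.le_div_iff_mul_le (Or.inl (by simpa using Real.exp_pos a)) (Or.inl (by simp)),
    mul_comm]
  exact hmarkov.trans hmom

theorem exp_le_re_trace_exp_smul {ι : Type*} [Fintype ι] [DecidableEq ι] {A : Matrix ι ι ℂ}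
    (hA : A.IsHermitian) {r : ℝ} (hr : r ∈ spectrum ℝ A) {θ : ℝ} (hθ : θ ≠ 0) :
    Real.exp (θ * r) ≤ (exp (θ • A)).trace.re := by
  have hB : (θ • A).IsHermitian := by simp [Matrix.IsHermitian, hA.eq]
  have hmem : θ * r ∈ spectrum ℝ (θ • A) := by
    have := (spectrum.smul_mem_smul_iff (r := Units.mk0 θ hθ)).2 hr
    simpa [Units.smul_def] using this
  rw [hB.spectrum_real_eq_range_eigenvalues] at hmem
  obtain ⟨i, hi⟩ := hmem
  rw [trace_exp_eq_sum_exp_eigenvalues hB, Complex.ofReal_re, ← hi]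
  exact Finset.single_le_sum (f := fun i => Real.exp (hB.eigenvalues i))
    (fun _ _ => (Real.exp_pos _).le) (Finset.mem_univ i)

theorem IsUniformSample.one_sub_le_measureReal_wellConditioned (hx : IsUniformSample μ x)
    (hΓ : Γ.Nonempty) (hn : 0 < n) {ε δ : ℝ} (hε : 0 < ε) (hε1 : ε < 1) (hδ : 0 < δ)
    (h : Real.log (2 * Γ.card / δ) ≤ ε ^ 2 * n / (3 * Γ.card)) :
    1 - δ ≤ μ.real {ω | WellConditioned ε Γ fun t => x t ω} := by
  have hD : (0 : ℝ) < Γ.card := by exact_mod_cast hΓ.card_pos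
  have hn' : (0 : ℝ) < n := Nat.cast_pos.2 hn
  have htail : Γ.card * Real.exp (-(ε ^ 2 * n / (3 * Γ.card))) ≤ δ / 2 := by
    calc Γ.card * Real.exp (-(ε ^ 2 * n / (3 * Γ.card)))
        ≤ Γ.card * Real.exp (-Real.log (2 * Γ.card / δ)) := by gcongr
      _ = δ / 2 := by
        rw [Real.exp_neg, Real.exp_log (by positivity)]
        field_simp
  have hlogpos : 0 < Real.log (1 + ε) := Real.log_pos (by linarith)
  -- `θ₁` is the exact minimiser of the upper-tail exponent; `θ₂` is a first-order substitute for
  -- the optimal `log (1 - ε) / D`.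
  set θ₁ := Real.log (1 + ε) / Γ.card with hθ₁
  set θ₂ := -(ε / Γ.card) with hθ₂
  have hθ₁pos : 0 < θ₁ := div_pos hlogpos hD
  have hθ₂neg : θ₂ < 0 := neg_neg_of_pos (div_pos hε hD)
  set B₁ := {ω | Real.exp (θ₁ * ((1 + ε) * n)) ≤ (exp (θ₁ • gram Γ fun t => x t ω)).trace.re}
  set B₂ := {ω | Real.exp (θ₂ * ((1 - ε) * n)) ≤ (exp (θ₂ • gram Γ fun t => x t ω)).trace.re}
  have hB₁ : μ B₁ ≤ ENNReal.ofReal (δ / 2) := by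
    refine (hx.measure_le_trace_exp_gram hΓ θ₁ _).trans (ENNReal.ofReal_le_ofReal ?_)
    refine le_trans ?_ htail
    gcongr
    have e1 : θ₁ * Γ.card = Real.log (1 + ε) := div_mul_cancel₀ _ hD.ne'
    rw [e1, Real.exp_log (by linarith)]
    have hlog := Real.le_log_one_add_of_nonneg hε.le
    -- From `log (1 + ε) ≥ 2 ε / (2 + ε)` the gain is `ε² / (2 + ε)`; since `ε < 1` it is at least
    -- `ε² / 3`, the source of the constant `3`.
    have hkey : ε + ε ^ 2 / 3 ≤ (1 + ε) * Real.log (1 + ε) := by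
      calc ε + ε ^ 2 / 3 ≤ (1 + ε) * (2 * ε / (ε + 2)) := by
            rw [mul_div_assoc', le_div_iff₀ (by linarith)]
            nlinarith [pow_pos hε 2, pow_pos hε 3]
        _ ≤ _ := by gcongr
    have : n * ((1 + ε - 1) / (Γ.card : ℝ)) - θ₁ * ((1 + ε) * n) + ε ^ 2 * n / (3 * Γ.card)
        = (n / Γ.card) * (ε + ε ^ 2 / 3 - (1 + ε) * Real.log (1 + ε)) := by
      rw [hθ₁]; field_simp; ring
    have h2 : (n / Γ.card : ℝ) * (ε + ε ^ 2 / 3 - (1 + ε) * Real.log (1 + ε)) ≤ 0 :=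
      mul_nonpos_of_nonneg_of_nonpos (by positivity) (by linarith)
    linarith
  have hB₂ : μ B₂ ≤ ENNReal.ofReal (δ / 2) := by
    refine (hx.measure_le_trace_exp_gram hΓ θ₂ _).trans (ENNReal.ofReal_le_ofReal ?_)
    refine le_trans ?_ htail
    gcongr
    have e1 : θ₂ * Γ.card = -ε := by rw [hθ₂]; field_simp
    rw [e1]
    -- Uses `(1 - ε + ε²/2)(1 + ε + ε²/2) = 1 + ε⁴/4 ≥ 1`. The lower-tail exponent then has slack
    -- `ε² / 6`.
    have hkey : Real.exp (-ε) ≤ 1 - ε + ε ^ 2 / 2 := by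
      rw [Real.exp_neg, inv_le_comm₀ (Real.exp_pos _) (by nlinarith)]
      refine le_trans ?_ (Real.quadratic_le_exp_of_nonneg hε.le)
      rw [inv_le_iff_one_le_mul₀ (by nlinarith)]
      nlinarith [sq_nonneg (ε ^ 2)]
    have : n * ((Real.exp (-ε) - 1) / (Γ.card : ℝ)) - θ₂ * ((1 - ε) * n)
          + ε ^ 2 * n / (3 * Γ.card)
        = (n / Γ.card) * (Real.exp (-ε) - 1 + ε * (1 - ε) + ε ^ 2 / 3) := by
      rw [hθ₂]; field_simp; ring
    have h2 : (n / Γ.card : ℝ) * (Real.exp (-ε) - 1 + ε * (1 - ε) + ε ^ 2 / 3) ≤ 0 :=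
      mul_nonpos_of_nonneg_of_nonpos (by positivity) (by nlinarith)
    linarith
  have hsub : {ω | WellConditioned ε Γ fun t => x t ω}ᶜ ⊆ B₁ ∪ B₂ := by
    intro ω hω
    by_contra hcon
    simp only [Set.mem_union, not_or] at hcon
    refine hω (wellConditioned_of_spectrum_gram_subset hΓ hn hε1 fun r hr => ?_)
    have h1 := exp_le_re_trace_exp_smul (isHermitian_gram Γ _) hr hθ₁pos.ne'
    have h2 := exp_le_re_trace_exp_smul (isHermitian_gram Γ _) hr hθ₂neg.ne
    have h1' := Real.exp_lt_exp.1 (h1.trans_lt (not_le.1 hcon.1))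
    have h2' := Real.exp_lt_exp.1 (h2.trans_lt (not_le.1 hcon.2))
    exact ⟨(mul_lt_mul_left_of_neg hθ₂neg).1 h2', (mul_lt_mul_iff_right₀ hθ₁pos).1 h1'⟩
  have hcompl : μ.real {ω | WellConditioned ε Γ fun t => x t ω}ᶜ ≤ δ := by
    refine ENNReal.toReal_le_of_le_ofReal hδ.le ?_
    calc _ ≤ μ (B₁ ∪ B₂) := measure_mono hsub
      _ ≤ μ B₁ + μ B₂ := measure_union_le _ _
      _ ≤ ENNReal.ofReal (δ / 2) + ENNReal.ofReal (δ / 2) := add_le_add hB₁ hB₂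
      _ = ENNReal.ofReal δ := by
        rw [← ENNReal.ofReal_add (by linarith) (by linarith)]; congr 1; ring
  -- Subadditivity suffices here, so the event need not be shown measurable.
  have hone : 1 ≤ μ.real {ω | WellConditioned ε Γ fun t => x t ω} +
      μ.real {ω | WellConditioned ε Γ fun t => x t ω}ᶜ := by
    rw [← probReal_univ (μ := μ), ← Set.union_compl_self {ω | WellConditioned ε Γ fun t => x t ω}]
    exact measureReal_union_le _ _
  linarith

/-- A single frequency makes the Gram matrix the scalar `n`, whatever the points. -/
theorem wellConditioned_of_card_eq_one (hcard : Γ.card = 1) (hn : 0 < n) {ε : ℝ} (hε : 0 < ε)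
    (hε1 : ε < 1) (z : Fin n → Fin d → ℝ) : WellConditioned ε Γ z := by
  have hΓ : Γ.Nonempty := Finset.card_pos.1 (by omega)
  have : Nonempty Γ := hΓ.to_subtype
  have : Subsingleton Γ := by
    rw [← Fintype.card_le_one_iff_subsingleton, Fintype.card_coe, hcard]
  have hn' : (0 : ℝ) < n := Nat.cast_pos.2 hn
  have hgram : gram Γ z = algebraMap ℝ (Matrix Γ Γ ℂ) n := by
    ext k l
    obtain rfl := Subsingleton.elim k l
    rw [gram_eq_sum_rankOneGram, Matrix.sum_apply, Matrix.algebraMap_matrix_apply]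
    simp [rankOneGram, vecMulVec_apply, ← Complex.normSq_eq_conj_mul_self,
      Complex.normSq_eq_norm_sq, norm_fourierRow]
  refine wellConditioned_of_spectrum_gram_subset hΓ hn hε1 ?_
  rw [hgram, spectrum.scalar_eq, Set.singleton_subset_iff]
  constructor <;> nlinarith

end Tail

end RandomFourier

end

/-! ### Deducing the three sample-size conditions -/

namespace RandomFourier

/-- Tangent line of `log` at `2`, with `log 2 < 1`. It trades `α / log (ε² / α)` for `ε² / 2` in
(a). -/
theorem two_mul_log_le {r : ℝ} (hr : 0 < r) : 2 * Real.log r ≤ r := by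
  have h := Real.log_le_sub_one_of_pos (x := r / 2) (by positivity)
  rw [Real.log_div hr.ne' two_ne_zero] at h
  linarith [Real.log_two_lt_d9]

theorem log_two_mul_div_eq_add {D δ : ℝ} (hD : 0 < D) (hδ : 0 < δ) :
    Real.log (2 * D / δ) = Real.log 2 + Real.log (D / δ) := by
  rw [mul_div_assoc, Real.log_mul two_ne_zero (by positivity)]

end RandomFourier

open RandomFourier in
theorem mainTheorem1 (ε δ : ℝ) (hε : 0 < ε) (hε1 : ε < 1) (hδ : 0 < δ) :
    ∃ C : ℝ, 0 < C ∧
      ∀ (d n : ℕ) (Γ : Finset (Fin d → ℤ)), Γ.Nonempty →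
      ∀ (Ω : Type*) [MeasurableSpace Ω] (μ : Measure Ω) [IsProbabilityMeasure μ]
        (x : Fin n → Ω → Fin d → ℝ), RandomFourier.IsUniformSample μ x →
        (∀ α : ℝ, 0 < α → α < ε ^ 2 →
          ((⌊α * (n : ℝ) / (3 * (Γ.card : ℝ))⌋ : ℤ) : ℝ) ≥
            (Real.log (ε ^ 2 / α))⁻¹ * Real.log ((Γ.card : ℝ) / (δ * (1 - α))) →
          μ.real {ω | RandomFourier.WellConditioned ε Γ (fun t => x t ω)} ≥ 1 - δ) ∧
        ((n : ℝ) ≥ 3 * (Γ.card : ℝ) * Real.exp 1 / ε ^ 2 *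
            (Real.log ((Γ.card : ℝ) / δ) + 2 - Real.log (Real.exp 1 - 1)) →
          μ.real {ω | RandomFourier.WellConditioned ε Γ (fun t => x t ω)} ≥ 1 - δ) ∧
        (2 ≤ Γ.card → (n : ℝ) ≥ C * ((Γ.card : ℝ) * Real.log (Γ.card : ℝ)) →
          μ.real {ω | RandomFourier.WellConditioned ε Γ (fun t => x t ω)} ≥ 1 - δ) := by
  have hlog2 : 0 < Real.log 2 := Real.log_pos one_lt_two
  -- Since `log D ≥ log 2`, the factor `2 + |log δ| / log 2` times `log D` dominates `log 2 + log D
  -- + |log δ|`.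
  refine ⟨3 / ε ^ 2 * (2 + |Real.log δ| / Real.log 2), by positivity, ?_⟩
  intro d n Γ hΓ Ω _ μ _ x hx
  rcases le_or_gt 1 δ with hδ1 | hδ1
  · have : 1 - δ ≤ μ.real {ω | WellConditioned ε Γ fun t => x t ω} :=
      (sub_nonpos.2 hδ1).trans measureReal_nonneg
    exact ⟨fun _ _ _ _ => this, fun _ => this, fun _ _ => this⟩
  have hcard : 1 ≤ Γ.card := hΓ.card_pos
  have hD1 : (1 : ℝ) ≤ Γ.card := by exact_mod_cast hcard
  have hD : (0 : ℝ) < Γ.card := by linarith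
  have hlogDδ : 0 < Real.log (Γ.card / δ) := Real.log_pos (by rw [lt_div_iff₀ hδ]; linarith)
  have hmain : Real.log (2 * Γ.card / δ) ≤ ε ^ 2 * n / (3 * Γ.card) →
      1 - δ ≤ μ.real {ω | WellConditioned ε Γ fun t => x t ω} := by
    intro h
    have hn : 0 < n := by
      rcases Nat.eq_zero_or_pos n with rfl | hn
      · rw [log_two_mul_div_eq_add hD hδ] at h
        simp only [Nat.cast_zero, mul_zero, zero_div] at h
        linarith
      · exact hn
    exact hx.one_sub_le_measureReal_wellConditioned hΓ hn hε hε1 hδ h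
  refine ⟨fun α hα hαε h => ?_, fun h => ?_, fun hD2 h => ?_⟩
  · have hα1 : α < 1 := hαε.trans (by nlinarith)
    set r := ε ^ 2 / α with hr
    have hr1 : 1 < r := by rw [hr, lt_div_iff₀ hα]; linarith
    have hlogr : 0 < Real.log r := Real.log_pos hr1
    have hL : Real.log (Γ.card / δ) ≤ Real.log (Γ.card / (δ * (1 - α))) := by
      refine Real.log_le_log (by positivity) ?_
      exact div_le_div_of_nonneg_left hD.le (mul_pos hδ (by linarith)) (by nlinarith)
    have hm : (Real.log r)⁻¹ * Real.log (Γ.card / δ) ≤ α * n / (3 * Γ.card) :=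
      calc _ ≤ (Real.log r)⁻¹ * Real.log (Γ.card / (δ * (1 - α))) := by gcongr
        _ ≤ _ := h.le.trans (Int.floor_le _)
    have hscale : 2 * Real.log (Γ.card / δ) ≤ ε ^ 2 * n / (3 * Γ.card) := by
      have h1 : 2 * Real.log (Γ.card / δ) ≤ r * ((Real.log r)⁻¹ * Real.log (Γ.card / δ)) := by
        rw [← mul_assoc]
        gcongr
        rw [← div_eq_mul_inv, le_div_iff₀ hlogr]
        exact two_mul_log_le (by linarith)
      have h2 : ε ^ 2 * n / (3 * Γ.card) = r * (α * n / (3 * Γ.card)) := by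
        rw [hr]; field_simp
      rw [h2]
      exact h1.trans (mul_le_mul_of_nonneg_left hm (by linarith))
    -- The bound `2 log (D / δ)` covers `log 2 + log (D / δ)` only if `D / δ ≥ 2`, which can fail
    -- for `D = 1`.
    rcases hcard.eq_or_lt' with h1 | h1
    · have hn : 0 < n := by
        rcases Nat.eq_zero_or_pos n with rfl | hn
        · simp only [Nat.cast_zero, mul_zero, zero_div] at hscale
          linarith
        · exact hn
      have hall : {ω | WellConditioned ε Γ fun t => x t ω} = Set.univ :=
        Set.eq_univ_of_forall fun ω => wellConditioned_of_card_eq_one h1 hn hε hε1 _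
      rw [hall, probReal_univ]
      linarith
    · refine hmain ?_
      rw [log_two_mul_div_eq_add hD hδ]
      have h2 : Real.log 2 ≤ Real.log (Γ.card / δ) := by
        refine Real.log_le_log two_pos ?_
        rw [le_div_iff₀ hδ]
        have : (2 : ℝ) ≤ Γ.card := by exact_mod_cast h1
        linarith
      linarith
  · refine hmain ?_
    rw [log_two_mul_div_eq_add hD hδ]
    have he := Real.exp_one_gt_d9
    have he1 : Real.log (Real.exp 1 - 1) ≤ 1 := by
      rw [Real.log_le_iff_le_exp (by linarith)]
      linarith
    have h2 : Real.exp 1 * (Real.log (Γ.card / δ) + 2 - Real.log (Real.exp 1 - 1)) ≤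
        ε ^ 2 * n / (3 * Γ.card) := by
      calc _ = ε ^ 2 * (3 * Γ.card * Real.exp 1 / ε ^ 2 *
            (Real.log (Γ.card / δ) + 2 - Real.log (Real.exp 1 - 1))) / (3 * Γ.card) := by
            field_simp
        _ ≤ _ := by gcongr
    -- As `log (e - 1) ≤ 1`, the left side of `h2` is at least `e (log (D / δ) + 1)`, more than
    -- needed.
    nlinarith [Real.log_two_lt_d9]
  · refine hmain ?_
    rw [log_two_mul_div_eq_add hD hδ]
    have hD2' : Real.log 2 ≤ Real.log Γ.card :=
      Real.log_le_log two_pos (by exact_mod_cast hD2)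
    have h2 : (2 + |Real.log δ| / Real.log 2) * Real.log Γ.card ≤ ε ^ 2 * n / (3 * Γ.card) := by
      calc _ = ε ^ 2 * (3 / ε ^ 2 * (2 + |Real.log δ| / Real.log 2) *
            (Γ.card * Real.log Γ.card)) / (3 * Γ.card) := by
            field_simp
        _ ≤ _ := by gcongr
    have h3 : |Real.log δ| ≤ |Real.log δ| / Real.log 2 * Real.log Γ.card := by
      rw [div_mul_eq_mul_div, le_div_iff₀ hlog2]
      gcongr
    rw [Real.log_div hD.ne' hδ.ne']
    linarith [neg_abs_le (Real.log δ)]
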